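/- **Definitions.** Rings are associative; a ring $S$ need not have a unit unless stated. - Idempotents $e,f\in S$ are *equivalent*, $e\sim f$, if there are $x\in eSf$ and $y\in fSe$ with $e=xy$ and $f=yx$. A non-zero idempotent $p\in S$ is *infinite* if there is an idempotent $q\in S$ with $q=pq=qp$, $q\neq p$ and $q\sim p$. A simple ring $S$ is *purely infinite* if every non-zero right ideal of $S$ contains an infinite idempotent (of $S$). - $S$ is an *exchange ring* if for every $x\in S$ there are an idempotent $p\in xS$ and an element $s\in S$ with $p=x+s-xs$. (For unital $S$ this says: for every $x\in S$ there is an idempotent $p\in xS$ with $1-p\in(1-x)S$.) - Let $R$ be a unital ring. An element $u\in R$ is *quasi-invertible* if there is $v\in R$ with $(1-uv)R(1-vu)=0=(1-vu)R(1-uv)$. $R$ is a *QB-ring* if for all $a,b\in R$ with $Ra+Rb=R$ there is $y\in R$ such that $a+yb$ is quasi-invertible. - $R$ is *prime* if, for $x,y\in R$, $xRy=0$ implies $x=0$ or $y=0$ (the zero ring is allowed). **Proposition.** Let $R$ be a unital ring and let $I$ be a two-sided ideal of $R$ which, regarded as a ring in its own right (possibly without unit), is simple, purely infinite and an exchange ring.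 If the quotient ring $R/I$ is prime and a QB-ring, then $R$ is a QB-ring. -/

import Mathlib

namespace QBRing

section NonUnital

/- The notions in this section are for a possibly non-unital ring `S`. -/

variable {S : Type*} [NonUnitalRing S]

/-- `e ∼ f` (Murray-von Neumann): `e = xy` and `f = yx` for some `x ∈ eSf` and `y ∈ fSe`. -/
def MvNEquiv (e f : S) : Prop :=
  ∃ x y : S, x = e * x * f ∧ y = f * y * e ∧ e = x * y ∧ f = y * x

/-- A non-zero idempotent `p` is infinite if `q ∼ p` for some idempotent `q < p`. -/
def IsInfiniteIdempotent (p : S) : Prop :=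
  p ≠ 0 ∧ IsIdempotentElem p ∧
    ∃ q : S, IsIdempotentElem q ∧ p * q = q ∧ q * p = q ∧ q ≠ p ∧ MvNEquiv q p

/-- An additive subgroup `K` of `S` is a right ideal if `K S ⊆ K`. -/
def IsRightIdeal (K : AddSubgroup S) : Prop :=
  ∀ x ∈ K, ∀ s : S, x * s ∈ K

variable (S)

/-- A simple ring (no unit required) in which every non-zero right ideal contains an
infinite idempotent. (The latter forces `S * S ≠ 0` for a non-zero `S`.) -/
def IsPurelyInfiniteSimple : Prop :=
  IsSimpleRing S ∧
    ∀ K : AddSubgroup S, IsRightIdeal K → K ≠ ⊥ → ∃ p ∈ K, IsInfiniteIdempotent p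

/-- A possibly non-unital ring is an exchange ring if for every `x` there are an idempotent
`p ∈ xS` and an `s` with `p = x + s - xs`; when `S` is unital the second condition says
`1 - p = (1 - x)(1 - s)`, that is, `1 - p ∈ (1 - x)S`. -/
def IsExchangeRing : Prop :=
  ∀ x : S, ∃ p r s : S, IsIdempotentElem p ∧ p = x * r ∧ p = x + s - x * s

end NonUnital

section Unital

variable {R : Type*} [Ring R]

/-- `x ⊥ y`: the elements are centrally orthogonal, `xRy = yRx = 0`. -/
def CentrallyOrthogonal (x y : R) : Prop :=
  (∀ r : R, x * r * y = 0) ∧ (∀ r : R, y * r * x = 0)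

/-- `u` is quasi-invertible: `(1 - uv) ⊥ (1 - vu)` for some `v`. -/
def IsQuasiInvertible (u : R) : Prop :=
  ∃ v : R, CentrallyOrthogonal (1 - u * v) (1 - v * u)

variable (R)

/-- `R` is a QB-ring: whenever `Ra + Rb = R`, some `a + yb` is quasi-invertible.
(`Ideal.span {a}` is the left ideal `Ra`.) -/
def IsQBRing : Prop :=
  ∀ a b : R, Ideal.span {a} ⊔ Ideal.span {b} = (⊤ : Ideal R) →
    ∃ y : R, IsQuasiInvertible (a + y * b)

/-- `R` is a prime ring: `xRy = 0` only if `x = 0` or `y = 0`. The zero ring is not excluded. -/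
def IsPrimeRing : Prop :=
  ∀ x y : R, (∀ r : R, x * r * y = 0) → x = 0 ∨ y = 0

end Unital

end QBRing

/-! In a prime ring, quasi-invertible means one-sided invertible. So the QB property of `R/I` lets
`a` be changed to be one-sided invertible modulo `I`, and the exchange property yields `v` with `v *
a * v = v` and one of `f = 1 - v * a`, `g = 1 - a * v` in `I`. Since `v` inverts `a` between `v * a`
and `a * v`, only the corner `a * f = g * a` matters (`exists_isQuasiInvertible_add`).

There, exchange splits `f` as `e + (f - e)`, with `a` left invertible on `e` and `f - e` a left
multiple of `b`. Hence `a` may be replaced on `f - e` by any map into the uncovered part of `g`.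
Pure infiniteness embeds one of these two remainders in the other, unless they are centrally
orthogonal (`exists_relative_quasiInverse`). -/

namespace QBRing

/-! ### Factorization in purely infinite simple rings -/

section PurelyInfinite

variable {S : Type*} [NonUnitalRing S]

/-- The two-sided ideal additively generated by all products `x * r * y`. -/
def sandwichIdeal (r : S) : TwoSidedIdeal S :=
  TwoSidedIdeal.mk' (AddSubgroup.closure {z | ∃ x y, z = x * r * y} : AddSubgroup S)
    (zero_mem _) (fun hx hy => add_mem hx hy) (fun hx => neg_mem hx)
    (by
      intro x y hy
      induction hy using AddSubgroup.closure_induction with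
      | mem z hz =>
        obtain ⟨u, v, rfl⟩ := hz
        exact AddSubgroup.subset_closure ⟨x * u, v, by simp only [mul_assoc]⟩
      | zero => rw [mul_zero]; exact zero_mem _
      | add u v _ _ hu hv => rw [mul_add]; exact add_mem hu hv
      | neg u _ hu => rw [mul_neg]; exact neg_mem hu)
    (by
      intro x y hx
      induction hx using AddSubgroup.closure_induction with
      | mem z hz =>
        obtain ⟨u, v, rfl⟩ := hz
        exact AddSubgroup.subset_closure ⟨u, v * y, by simp only [mul_assoc]⟩
      | zero => rw [zero_mul]; exact zero_mem _
      | add u v _ _ hu hv => rw [add_mul]; exact add_mem hu hv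
      | neg u _ hu => rw [neg_mul]; exact neg_mem hu)

theorem mem_sandwichIdeal {r z : S} :
    z ∈ sandwichIdeal r ↔ z ∈ AddSubgroup.closure {z | ∃ x y, z = x * r * y} := by
  simp [sandwichIdeal, TwoSidedIdeal.mem_mk']

/-- In a simple ring, every element is a sum of products `x * r * y`, for a fixed non-zero
idempotent `r`. -/
theorem mem_closure_of_isSimpleRing [IsSimpleRing S] {r : S} (hr : r ≠ 0)
    (hi : IsIdempotentElem r) (w : S) :
    w ∈ AddSubgroup.closure {z | ∃ x y, z = x * r * y} := by
  rw [← mem_sandwichIdeal]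
  rcases eq_bot_or_eq_top (sandwichIdeal r) with h | h
  · refine absurd ?_ hr
    have : r ∈ sandwichIdeal r :=
      mem_sandwichIdeal.2 (AddSubgroup.subset_closure ⟨r, r, by rw [hi.eq, hi.eq]⟩)
    rwa [h, TwoSidedIdeal.mem_bot] at this
  · rw [h]; trivial

/-- In a simple ring, every element factors through any infinite idempotent. -/
theorem exists_eq_mul_mul_of_isInfiniteIdempotent [IsSimpleRing S] {p : S}
    (hp : IsInfiniteIdempotent p) (w : S) : ∃ x y, w = x * p * y := by
  obtain ⟨-, hpp, q, hq, hpq, hqp, hne, s, t, hs, ht, hst, hts⟩ := hp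
  have hpp' : p * p = p := hpp
  have hqq : q * q = q := hq
  have hqs : q * s = s := by rw [hs]; simp only [← mul_assoc, hqq]
  have htq : t * q = t := by rw [ht]; simp only [mul_assoc, hqq]
  have htp : t * p = t := by rw [← htq, mul_assoc, hqp]
  have hps : p * s = s := by rw [← hqs, ← mul_assoc, hpq]
  have hr : (p - q) * (p - q) = p - q := by
    simp only [sub_mul, mul_sub, hpp', hpq, hqp, hqq]; abel
  have hrs : (p - q) * s = 0 := by rw [sub_mul, hps, hqs, sub_self]
  have htr : t * (p - q) = 0 := by rw [mul_sub, htp, htq, sub_self]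
  have hrp : (p - q) * p = p - q := by rw [sub_mul, hpp', hqp]
  have hpr : p * (p - q) = p - q := by rw [mul_sub, hpp', hpq]
  have main := mem_closure_of_isSimpleRing (sub_ne_zero.2 hne.symm) hr w
  -- As `p = t * s` and `q = s * t`, the idempotent `p` contains `p - q` and, orthogonal to it, the
  -- copy `q` of itself. Sums of products thus collapse one term at a time.
  have step : ∀ x y X Y : S, ∃ X' Y', x * (p - q) * y + X * p * Y = X' * p * Y' := by
    intro x y X Y
    refine ⟨x * (p - q) + X * t, (p - q) * y + s * Y, ?_⟩
    have e1 : (x * (p - q) + X * t) * p = x * (p - q) + X * t := by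
      rw [add_mul, mul_assoc, hrp, mul_assoc, htp]
    rw [e1, add_mul, mul_add, mul_add]
    have h1 : x * (p - q) * ((p - q) * y) = x * (p - q) * y := by
      rw [← mul_assoc, mul_assoc x, hr]
    have h2 : x * (p - q) * (s * Y) = 0 := by
      rw [← mul_assoc, mul_assoc x, hrs, mul_zero, zero_mul]
    have h3 : X * t * ((p - q) * y) = 0 := by
      rw [← mul_assoc, mul_assoc X, htr, mul_zero, zero_mul]
    have h4 : X * t * (s * Y) = X * p * Y := by
      rw [← mul_assoc, mul_assoc X, ← hts]
    rw [h1, h2, h3, h4, add_zero, zero_add]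
  induction main using AddSubgroup.closure_induction_left with
  | zero => exact ⟨0, 0, by simp⟩
  | add_left x hx y _ ih =>
    obtain ⟨u, v, rfl⟩ := hx
    obtain ⟨X, Y, rfl⟩ := ih
    exact step u v X Y
  | neg_add_cancel x hx y _ ih =>
    obtain ⟨u, v, rfl⟩ := hx
    obtain ⟨X, Y, rfl⟩ := ih
    rw [← neg_mul, ← neg_mul]
    exact step (-u) v X Y

/-- In a purely infinite simple ring, every element factors through any non-zero element. -/
theorem IsPurelyInfiniteSimple.exists_eq_mul_mul (h : IsPurelyInfiniteSimple S) {z : S}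
    (hz : z ≠ 0) (w : S) : ∃ x y, w = x * z * y := by
  obtain ⟨_, h⟩ := h
  -- The right ideal generated by `z`; integer multiples are needed without a unit, and `p = p * p`
  -- removes them below.
  let K : AddSubgroup S :=
    { carrier := {k | ∃ (n : ℤ) (s : S), k = n • z + z * s}
      zero_mem' := ⟨0, 0, by simp⟩
      add_mem' := by
        rintro _ _ ⟨n, s, rfl⟩ ⟨m, t, rfl⟩
        exact ⟨n + m, s + t, by rw [add_smul, mul_add]; abel⟩
      neg_mem' := by
        rintro _ ⟨n, s, rfl⟩
        exact ⟨-n, -s, by rw [neg_smul, mul_neg, neg_add]⟩ }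
  have hzK : z ∈ K := ⟨1, 0, by simp⟩
  obtain ⟨p, ⟨n, s, hp⟩, hinf⟩ := h K
    (by
      rintro _ ⟨n, s, rfl⟩ t
      exact ⟨0, n • t + s * t, by
        rw [add_mul, mul_add, smul_mul_assoc, mul_smul_comm, mul_assoc, zero_smul, zero_add]⟩)
    (fun hK => hz (by rwa [hK, AddSubgroup.mem_bot] at hzK))
  obtain ⟨x, y, rfl⟩ := exists_eq_mul_mul_of_isInfiniteIdempotent hinf w
  refine ⟨x, (n • p + s * p) * y, ?_⟩
  have hpz : p = z * (n • p + s * p) := by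
    have hpp : p * p = p := hinf.2.1
    calc p = (n • z + z * s) * p := by rw [← hp, hpp]
      _ = _ := by rw [add_mul, mul_add, smul_mul_assoc, mul_smul_comm, mul_assoc]
  rw [mul_assoc x z, ← mul_assoc z, ← hpz, mul_assoc]

end PurelyInfinite

/-! ### Comparing idempotents when one lies in the ideal -/

section Ideals

variable {R : Type*} [Ring R] {I : TwoSidedIdeal R}

theorem exists_mem_eq_mul_mul (hI : IsPurelyInfiniteSimple I) {z w : R} (hz : z ∈ I)
    (hz0 : z ≠ 0) (hw : w ∈ I) : ∃ x y, y ∈ I ∧ w = x * z * y := by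
  obtain ⟨x, y, h⟩ := hI.exists_eq_mul_mul (z := (⟨z, hz⟩ : I))
    (fun h => hz0 (congrArg Subtype.val h)) ⟨w, hw⟩
  exact ⟨x, y, y.2, congrArg Subtype.val h⟩

/-- The left and right annihilators of a purely infinite simple ideal agree. -/
theorem mul_eq_zero_of_left_annihilator (hI : IsPurelyInfiniteSimple I) {k : R}
    (hk : ∀ w ∈ I, k * w = 0) {w : R} (hw : w ∈ I) : w * k = 0 := by
  by_contra h
  have hwk : w * k ∈ I := I.mul_mem_right _ _ hw
  obtain ⟨x, y, hy, hxy⟩ := exists_mem_eq_mul_mul hI hwk h hwk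
  exact h (by rw [hxy, mul_assoc, mul_assoc w, hk y hy, mul_zero, mul_zero])

theorem CentrallyOrthogonal.symm {x y : R} (h : CentrallyOrthogonal x y) :
    CentrallyOrthogonal y x :=
  ⟨h.2, h.1⟩

theorem CentrallyOrthogonal.zero_left (x : R) : CentrallyOrthogonal 0 x :=
  ⟨fun r => by simp, fun r => by simp⟩

theorem centrallyOrthogonal_of_annihilator (hI : IsPurelyInfiniteSimple I) {k l : R}
    (hl : ∀ w ∈ I, l * w = 0) (hk : k ∈ I) : CentrallyOrthogonal l k :=
  ⟨fun r => by rw [mul_assoc, hl _ (I.mul_mem_left _ _ hk)],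
    fun r => mul_eq_zero_of_left_annihilator hI hl (I.mul_mem_right _ _ hk)⟩

/-- An idempotent `k` of a purely infinite simple ideal is either centrally orthogonal to a
given idempotent `l`, or equivalent to an idempotent below it. -/
theorem centrallyOrthogonal_or_exists_mul_eq (hI : IsPurelyInfiniteSimple I) {k l : R}
    (hk : k * k = k) (hl : l * l = l) (hkI : k ∈ I) :
    CentrallyOrthogonal l k ∨
      ∃ w w', l * w = w ∧ w * k = w ∧ k * w' = w' ∧ w' * l = w' ∧ w' * w = k := by
  by_cases h : ∀ w ∈ I, l * w = 0
  · exact .inl (centrallyOrthogonal_of_annihilator hI h hkI)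
  · push Not at h
    obtain ⟨v, hv, hlv⟩ := h
    obtain ⟨x, y, -, hxy⟩ := exists_mem_eq_mul_mul hI (I.mul_mem_left _ _ hv) hlv hkI
    refine .inr ⟨l * v * y * k, k * x * l, ?_, ?_, ?_, ?_, ?_⟩
    · simp only [← mul_assoc, hl]
    · simp only [mul_assoc, hk]
    · simp only [← mul_assoc, hk]
    · simp only [mul_assoc, hl]
    · calc k * x * l * (l * v * y * k) = k * (x * (l * l * v) * y) * k := by
            simp only [mul_assoc]
        _ = k := by rw [hl, ← hxy, hk, hk]

/-- If the idempotent in `I` embeds in the other one, its own defect vanishes; otherwise the two are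
centrally orthogonal and `w = w' = 0` works. -/
theorem exists_relative_quasiInverse (hI : IsPurelyInfiniteSimple I) {k l : R}
    (hk : k * k = k) (hl : l * l = l) (h : k ∈ I ∨ l ∈ I) :
    ∃ w w', l * w = w ∧ w * k = w ∧ k * w' = w' ∧ w' * l = w' ∧
      CentrallyOrthogonal (l - w * w') (k - w' * w) := by
  have triv (hlk : CentrallyOrthogonal l k) :
      ∃ w w', l * w = w ∧ w * k = w ∧ k * w' = w' ∧ w' * l = w' ∧
        CentrallyOrthogonal (l - w * w') (k - w' * w) :=
    ⟨0, 0, by simp, by simp, by simp, by simp, by simpa using hlk⟩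
  rcases h with h | h
  · rcases centrallyOrthogonal_or_exists_mul_eq hI hk hl h with h | ⟨w, w', h1, h2, h3, h4, h5⟩
    · exact triv h
    · exact ⟨w, w', h1, h2, h3, h4, by
        rw [h5, sub_self]; exact (CentrallyOrthogonal.zero_left _).symm⟩
  · rcases centrallyOrthogonal_or_exists_mul_eq hI hl hk h with h | ⟨w, w', h1, h2, h3, h4, h5⟩
    · exact triv h.symm
    · exact ⟨w', w, h3, h4, h1, h2, by
        rw [h5, sub_self]; exact CentrallyOrthogonal.zero_left _⟩

/-! ### Exchange property for elements of the ideal and in corners -/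

theorem IsExchangeRing.exists_right (hI : IsExchangeRing I) {x : R} (hx : x ∈ I) :
    ∃ p r t : R, p * p = p ∧ p = x * r ∧ 1 - p = (1 - x) * t := by
  obtain ⟨p, r, s, hp, h1, h2⟩ := hI ⟨x, hx⟩
  have h2' : (p : R) = x + s - x * s := congrArg Subtype.val h2
  exact ⟨p, r, 1 - s, congrArg Subtype.val hp.eq, congrArg Subtype.val h1, by
    rw [h2']; noncomm_ring⟩

/-- The exchange property is left-right symmetric, elementwise. -/
theorem exists_left_of_exists_right {x p r t : R} (hp : p * p = p) (hr : p = x * r)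
    (ht : 1 - p = (1 - x) * t) :
    ∃ e u v : R, e * e = e ∧ e = u * x ∧ 1 - e = v * (1 - x) := by
  -- The element `y` solves `x * y = 1 + y * (1 - p)`; this makes `(1 - y * x) * (1 - x)`
  -- idempotent, and it serves as `1 - e`.
  have hpq : (1 - p) * (1 - p) = 1 - p := IsIdempotentElem.one_sub hp
  obtain ⟨y, hy⟩ : ∃ y, y = r * p - t * (1 - p) := ⟨_, rfl⟩
  have hxy : x * y = 1 + y * (1 - p) := by
    have h1 : x * (r * p) = p := by rw [← mul_assoc, ← hr, hp]
    have h2 : x * (t * (1 - p)) = t * (1 - p) - (1 - p) := by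
      have : (1 - x) * (t * (1 - p)) = 1 - p := by
        rw [← mul_assoc, ← ht, hpq]
      rw [sub_mul, one_mul, sub_eq_iff_eq_add'] at this
      exact eq_sub_of_add_eq this.symm
    have h3 : y * (1 - p) = -(t * (1 - p)) := by
      have h5 : p * (1 - p) = 0 := by rw [mul_sub, hp]; simp
      rw [hy, sub_mul, mul_assoc, h5, mul_assoc, hpq, mul_zero, zero_sub]
    rw [h3, hy, mul_sub, h1, h2]; abel
  have hfy : (1 - y * x) * (1 - x) * y = y * x - 1 := by
    have h1 : (1 - x) * y = y - 1 - y * (1 - p) := by rw [sub_mul, hxy, one_mul, sub_sub]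
    have h2 : y * x * y = y + y * y * (1 - p) := by
      rw [mul_assoc, hxy]; noncomm_ring
    rw [mul_assoc, h1]
    calc (1 - y * x) * (y - 1 - y * (1 - p))
        = y - 1 - y * (1 - p) - y * x * y + y * x + y * x * y * (1 - p) := by noncomm_ring
      _ = y * x - 1 + (y * y * ((1 - p) * (1 - p)) - y * y * (1 - p)) := by
          rw [h2]; noncomm_ring
      _ = y * x - 1 := by rw [hpq]; simp
  have hf : (1 - y * x) * (1 - x) * ((1 - y * x) * (1 - x)) = (1 - y * x) * (1 - x) := by
    calc (1 - y * x) * (1 - x) * ((1 - y * x) * (1 - x))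
        = ((1 - y * x) * (1 - x) - (1 - y * x) * (1 - x) * y * x) * (1 - x) := by noncomm_ring
      _ = _ := by rw [hfy]; noncomm_ring
  refine ⟨1 - (1 - y * x) * (1 - x), 1 + y - y * x, 1 - y * x,
    IsIdempotentElem.one_sub hf, by noncomm_ring, by simp⟩

theorem IsExchangeRing.exists_left (hI : IsExchangeRing I) {x : R} (hx : x ∈ I) :
    ∃ e u v : R, e * e = e ∧ e = u * x ∧ 1 - e = v * (1 - x) := by
  obtain ⟨p, r, t, hp, hr, ht⟩ := hI.exists_right hx
  exact exists_left_of_exists_right hp hr ht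

theorem IsExchangeRing.exists_left_corner (hI : IsExchangeRing I) {x f : R} (hx : x ∈ I)
    (hf : f * f = f) (hxf : x * f = x) :
    ∃ e u v : R, e * e = e ∧ f * e = e ∧ e * f = e ∧ e = u * x ∧ f - e = v * (f - x) := by
  obtain ⟨e, u, v, he, hu, hv⟩ := hI.exists_left hx
  have hef : e * f = e := by rw [hu, mul_assoc, hxf]
  refine ⟨f * e, f * u, f * v, ?_, ?_, ?_, ?_, ?_⟩
  · rw [mul_assoc, ← mul_assoc e, hef, he]
  · rw [← mul_assoc, hf]
  · rw [mul_assoc, hef]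
  · rw [hu, mul_assoc]
  · calc f - f * e = f * (1 - e) * f := by rw [mul_sub, sub_mul, mul_one, hf, mul_assoc, hef]
      _ = f * v * (f - x) := by
        rw [hv, mul_assoc, mul_assoc, sub_mul, one_mul, hxf, mul_assoc]

/-! ### Quasi-invertibility in a corner and its extension to the ring -/

/-- The corner version of the main result: if `c * a + d * b = f`, with `a ∈ gRf` in the ideal,
then some `a + (g * z) * b` is quasi-invertible relative to `f` and `g`. -/
theorem exists_relative_quasiInverse_add (hI : IsPurelyInfiniteSimple I)
    (hex : IsExchangeRing I) {f g a b c d : R} (hf : f * f = f) (hg : g * g = g)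
    (hfg : f ∈ I ∨ g ∈ I) (hga : g * a = a) (haf : a * f = a)
    (h : c * a + d * b = f) :
    ∃ z m', f * m' = m' ∧ m' * g = m' ∧
      CentrallyOrthogonal (g - (a + g * z * b) * m') (f - m' * (a + g * z * b)) := by
  have haI : a ∈ I := by
    rcases hfg with hi | hi
    · rw [← haf]; exact I.mul_mem_left _ _ hi
    · rw [← hga]; exact I.mul_mem_right _ _ hi
  obtain ⟨e, u, v, he, hfe, hef, hu, hv⟩ := hex.exists_left_corner (x := f * c * a) (f := f)
    (I.mul_mem_left _ _ haI) hf (by rw [mul_assoc, haf])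
  have hfx : f - f * c * a = f * d * b := by
    rw [sub_eq_iff_eq_add, mul_assoc, mul_assoc, ← mul_add, add_comm (d * b), h, hf]
  rw [hfx, ← mul_assoc] at hv
  obtain ⟨D, hD⟩ : ∃ D, D = v * (f * d) := ⟨_, rfl⟩
  rw [← hD] at hv
  obtain ⟨c', hc'⟩ : ∃ c', c' = e * (u * (f * c)) * g := ⟨_, rfl⟩
  have hca : c' * a = e := by
    rw [hc', mul_assoc, hga, mul_assoc, mul_assoc u, ← hu, he]
  have hec : e * c' = c' := by rw [hc']; simp only [← mul_assoc, he]
  have hcg : c' * g = c' := by rw [hc', mul_assoc, hg]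
  have heI : e ∈ I := by rw [← hca]; exact I.mul_mem_left _ _ haI
  have hacc : a * c' * (a * c') = a * c' := by
    rw [mul_assoc, ← mul_assoc c', hca, hec]
  have hgac : g * (a * c') = a * c' := by rw [← mul_assoc, hga]
  have hacg : a * c' * g = a * c' := by rw [mul_assoc, hcg]
  have hk : (f - e) * (f - e) = f - e := by
    rw [sub_mul, mul_sub, mul_sub, hf, hfe, hef, he]; simp
  have hl : (g - a * c') * (g - a * c') = g - a * c' := by
    rw [sub_mul, mul_sub, mul_sub, hg, hgac, hacg, hacc]; simp
  have hkl : f - e ∈ I ∨ g - a * c' ∈ I :=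
    hfg.imp (fun hi => I.sub_mem hi heI) (fun hi => I.sub_mem hi (I.mul_mem_right _ _ haI))
  obtain ⟨w, w', hlw, hwk, hkw, hwl, horth⟩ := exists_relative_quasiInverse hI hk hl hkl
  have hgw : g * w = w := by rw [← hlw, ← mul_assoc, mul_sub, hg, hgac]
  -- Since `D * b = f - e`, this coefficient keeps `a` on `e` and substitutes `w` on `f - e`.
  have hm : a + g * (w - a) * D * b = a * e + w := by
    rw [mul_assoc, ← hv, mul_sub g, hgw, hga, sub_mul, hwk, mul_sub, haf]; abel
  have hcw : c' * w = 0 := by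
    rw [← hlw, ← mul_assoc, mul_sub, hcg, ← mul_assoc, hca, hec, sub_self, zero_mul]
  have hwa : w' * a * e = 0 := by
    rw [← hwl, mul_assoc, mul_assoc, sub_mul, ← mul_assoc, hga, mul_assoc, ← mul_assoc c', hca,
      he, sub_self, mul_zero]
  have hew : e * w' = 0 := by
    rw [← hkw, ← mul_assoc, mul_sub, hef, he, sub_self, zero_mul]
  have hwc : w * c' = 0 := by
    rw [← hwk, ← hec, mul_assoc, ← mul_assoc (f - e), sub_mul, hfe, he, sub_self, zero_mul,
      mul_zero]
  have hfc : f * c' = c' := by rw [← hec, ← mul_assoc, hfe]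
  have hfw : f * w' = w' := by rw [← hkw, ← mul_assoc, mul_sub, hf, hfe]
  have hwg : w' * g = w' := by rw [← hwl, mul_assoc, sub_mul, hg, hacg]
  refine ⟨(w - a) * D, c' + w', by rw [mul_add, hfc, hfw], by rw [add_mul, hcg, hwg], ?_⟩
  rw [← mul_assoc g, hm]
  have h1 : (a * e + w) * (c' + w') = a * c' + w * w' := by
    rw [add_mul, mul_add, mul_add, mul_assoc, hec, mul_assoc, hew, hwc]; simp
  have h2 : (c' + w') * (a * e + w) = e + w' * w := by
    rw [add_mul, mul_add, mul_add, ← mul_assoc, hca, he, hcw, ← mul_assoc, hwa]; simp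
  rwa [h1, h2, ← sub_sub, ← sub_sub]

theorem IsQuasiInvertible.unit_mul {q : R} (hq : IsQuasiInvertible q) (w : Rˣ) :
    IsQuasiInvertible (w * q) := by
  obtain ⟨v, h1, h2⟩ := hq
  have e1 : 1 - w * q * (v * ↑w⁻¹) = w * (1 - q * v) * ↑w⁻¹ := by
    rw [mul_sub, sub_mul, mul_one, Units.mul_inv]; simp only [mul_assoc]
  have e2 : 1 - v * ↑w⁻¹ * (w * q) = 1 - v * q := by
    rw [mul_assoc, Units.inv_mul_cancel_left]
  refine ⟨v * ↑w⁻¹, ?_⟩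
  rw [e1, e2]
  constructor
  · intro r
    calc w * (1 - q * v) * ↑w⁻¹ * r * (1 - v * q)
        = w * ((1 - q * v) * (↑w⁻¹ * r) * (1 - v * q)) := by simp only [mul_assoc]
      _ = 0 := by rw [h1, mul_zero]
  · intro r
    calc (1 - v * q) * r * (w * (1 - q * v) * ↑w⁻¹)
        = (1 - v * q) * (r * w) * (1 - q * v) * ↑w⁻¹ := by simp only [mul_assoc]
      _ = 0 := by rw [h2, zero_mul]

/-- The corner solution `m` is added to `a * v * a`, with quasi-inverse `v + m'`, so the defects are
those of the corner. -/
theorem exists_isQuasiInvertible_add (hI : IsPurelyInfiniteSimple I)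
    (hex : IsExchangeRing I) {a b c d v : R} (hv : v * a * v = v)
    (hfg : 1 - v * a ∈ I ∨ 1 - a * v ∈ I) (h : c * a + d * b = 1) :
    ∃ y, IsQuasiInvertible (a + y * b) := by
  obtain ⟨f, hf⟩ : ∃ f, f = 1 - v * a := ⟨_, rfl⟩
  obtain ⟨g, hg⟩ : ∃ g, g = 1 - a * v := ⟨_, rfl⟩
  rw [← hf, ← hg] at hfg
  have hfv : f * v = 0 := by rw [hf, sub_mul, hv]; simp
  have hvg : v * g = 0 := by rw [hg, mul_sub, ← mul_assoc, hv]; simp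
  have hff : f * f = f := by
    nth_rw 2 [hf]; rw [mul_sub, ← mul_assoc, hfv]; simp
  have hgg : g * g = g := by
    nth_rw 1 [hg]; rw [sub_mul, mul_assoc, hvg]; simp
  have hgaf : g * a = a * f := by rw [hf, hg]; noncomm_ring
  obtain ⟨z, m', hfm, hmg, ho⟩ := exists_relative_quasiInverse_add hI hex (a := a * f)
    (b := b * f) (c := f * c) (d := f * d) hff hgg hfg
    (by rw [← mul_assoc, hgaf, mul_assoc, hff]) (by rw [mul_assoc, hff])
    (by
      calc f * c * (a * f) + f * d * (b * f) = f * (c * a + d * b) * f := by noncomm_ring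
        _ = f := by rw [h, mul_one, hff])
  obtain ⟨m, hm⟩ : ∃ m, m = a * f + g * z * (b * f) := ⟨_, rfl⟩
  rw [← hm] at ho
  have hgm : g * m = m := by
    rw [hm, ← hgaf, mul_add]; simp only [← mul_assoc, hgg]
  have hmf : m * f = m := by
    rw [hm, add_mul]; simp only [mul_assoc, hff]
  have hvm : v * m = 0 := by rw [← hgm, ← mul_assoc, hvg, zero_mul]
  have hmv : m * v = 0 := by rw [← hmf, mul_assoc, hfv, mul_zero]
  have hvam : v * a * m' = 0 := by
    have : v * a * f = 0 := by rw [mul_assoc, ← hgaf, ← mul_assoc, hvg, zero_mul]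
    rw [← hfm, ← mul_assoc, this, zero_mul]
  have hmav : m' * (a * v) = 0 := by
    have : g * (a * v) = 0 := by rw [← mul_assoc, hgaf, mul_assoc, hfv, mul_zero]
    rw [← hmg, mul_assoc, this, mul_zero]
  have hq : IsQuasiInvertible (a * v * a + m) := by
    refine ⟨v + m', ?_⟩
    have e1 : (a * v * a + m) * (v + m') = a * v + m * m' := by
      calc (a * v * a + m) * (v + m')
          = a * (v * a * v) + a * (v * a * m') + m * v + m * m' := by noncomm_ring
        _ = _ := by rw [hv, hvam, hmv]; simp
    have e2 : (v + m') * (a * v * a + m) = v * a + m' * m := by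
      calc (v + m') * (a * v * a + m)
          = v * a * v * a + m' * (a * v) * a + v * m + m' * m := by noncomm_ring
        _ = _ := by rw [hv, hmav, hvm]; simp
    rw [e1, e2, ← sub_sub, ← sub_sub, ← hf, ← hg]
    exact ho
  have hnn : g * z * b * v * (g * z * b * v) = 0 := by
    calc g * z * b * v * (g * z * b * v) = g * z * b * (v * g) * (z * b * v) := by
          simp only [mul_assoc]
      _ = 0 := by rw [hvg, mul_zero, zero_mul]
  -- This unipotent unit restores the off-diagonal term `g * z * b * (v * a)`, which the corner does
  -- not see.
  let w : Rˣ :=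
    { val := 1 + g * z * b * v
      inv := 1 - g * z * b * v
      val_inv := by rw [add_mul, mul_sub, mul_sub, hnn]; simp
      inv_val := by rw [sub_mul, mul_add, mul_add, hnn]; simp }
  refine ⟨g * z, ?_⟩
  have : a + g * z * b = w * (a * v * a + m) := by
    have e3 : g * z * b * v * (a * v * a + m) = g * z * b * (v * a) := by
      calc g * z * b * v * (a * v * a + m)
          = g * z * b * (v * a * v) * a + g * z * b * (v * m) := by noncomm_ring
        _ = _ := by rw [hv, hvm]; noncomm_ring
    change _ = (1 + g * z * b * v) * (a * v * a + m)
    rw [add_mul, e3, hm, hf]; noncomm_ring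
  rw [this]
  exact hq.unit_mul w

/-- An element that is one-sided invertible modulo an exchange ideal has a generalized inverse
that is a one-sided inverse modulo the ideal. -/
theorem exists_generalized_inverse (hex : IsExchangeRing I) {a v : R}
    (h : 1 - a * v ∈ I ∨ 1 - v * a ∈ I) :
    ∃ v', v' * a * v' = v' ∧ (1 - v' * a ∈ I ∨ 1 - a * v' ∈ I) := by
  have idem {p : R} (hp : p * p = p) : (1 - p) * (1 - p) = 1 - p :=
    IsIdempotentElem.one_sub hp
  rcases h with h | h
  · obtain ⟨p, r, t, hp, hr, ht⟩ := hex.exists_right h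
    rw [sub_sub_cancel] at ht
    have key : a * (v * t * (1 - p)) = 1 - p := by
      rw [← mul_assoc, ← mul_assoc, ← ht, idem hp]
    refine ⟨v * t * (1 - p), by rw [mul_assoc, key, mul_assoc, idem hp], .inr ?_⟩
    rw [key, sub_sub_cancel, hr]
    exact I.mul_mem_right _ _ h
  · obtain ⟨p, r, t, hp, hr, ht⟩ := hex.exists_left h
    rw [sub_sub_cancel] at ht
    have key : (1 - p) * (t * v) * a = 1 - p := by
      rw [mul_assoc, mul_assoc t, ← ht, idem hp]
    refine ⟨(1 - p) * (t * v), by rw [key, ← mul_assoc, idem hp], .inl ?_⟩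
    rw [key, sub_sub_cancel, hr]
    exact I.mul_mem_left _ _ h

theorem IsPrimeRing.eq_one_of_isQuasiInvertible (hR : IsPrimeRing R) {u : R}
    (hu : IsQuasiInvertible u) : ∃ v, u * v = 1 ∨ v * u = 1 := by
  obtain ⟨v, h, -⟩ := hu
  exact ⟨v, (hR _ _ h).imp (fun h => (sub_eq_zero.1 h).symm) (fun h => (sub_eq_zero.1 h).symm)⟩

theorem span_sup_span_eq_top_iff {a b : R} :
    Ideal.span {a} ⊔ Ideal.span {b} = (⊤ : Ideal R) ↔ ∃ c d, c * a + d * b = 1 := by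
  simp [Ideal.eq_top_iff_one, Submodule.mem_sup, Ideal.mem_span_singleton']

end Ideals

end QBRing

theorem proposition3p2 {R : Type*} [Ring R] (I : TwoSidedIdeal R)
    (hpi : QBRing.IsPurelyInfiniteSimple I) (hex : QBRing.IsExchangeRing I)
    (hprime : QBRing.IsPrimeRing I.ringCon.Quotient)
    (hqb : QBRing.IsQBRing I.ringCon.Quotient) :
    QBRing.IsQBRing R := by
  intro a b hab
  obtain ⟨c, d, h⟩ := QBRing.span_sup_span_eq_top_iff.1 hab
  let π := I.ringCon.mk'
  have hπ : Function.Surjective π := I.ringCon.mk'_surjective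
  have hmem {x y : R} (hxy : π x = π y) : y - x ∈ I :=
    (TwoSidedIdeal.rel_iff I y x).1 ((RingCon.eq _).1 hxy.symm)
  obtain ⟨y', hy'⟩ := hqb (π a) (π b)
    (QBRing.span_sup_span_eq_top_iff.2 ⟨π c, π d, by rw [← map_mul, ← map_mul, ← map_add, h, map_one]⟩)
  obtain ⟨y, rfl⟩ := hπ y'
  obtain ⟨v', hv'⟩ := hprime.eq_one_of_isQuasiInvertible hy'
  obtain ⟨v, rfl⟩ := hπ v'
  simp only [← map_mul, ← map_add] at hv'
  rw [← map_one π] at hv'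
  obtain ⟨w, hw, hw'⟩ := QBRing.exists_generalized_inverse hex (hv'.imp hmem hmem)
  -- The coefficient `d - c * y` compensates for replacing `a` by `a + y * b`.
  obtain ⟨z, hz⟩ := QBRing.exists_isQuasiInvertible_add hpi hex (c := c) (d := d - c * y) (b := b) hw hw'
    (by rw [← h]; noncomm_ring)
  exact ⟨y + z, by rwa [add_mul, ← add_assoc]⟩
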